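/- A school choice problem $E=(I,S,q,\succsim,R)$ consists of a finite set $I$ of students, a finite set $S$ of schools, quotas $q_s\in\mathbb N$ ($s\in S$), a linear order $\succsim_s$ over $I$ for each school $s$ (its priority, with strict part $\succ_s$), and a linear order $R_i$ over $S\cup\{i\}$ for each student $i$ (his preference, with strict part $P_i$; the alternative $i$ means being unmatched). A matching is a map $\mu$ on $I$ with $\mu(i)\in S\cup\{i\}$ for all $i\in I$ and $|\mu^{-1}(s)|\le q_s$ for all $s\in S$. It is stable if (1) $\mu(i)\mathrel{R_i} i$ for all $i\in I$; (2) there are no $i,j\in I$ and $s\in S$ with $s=\mu(j)$, $s\mathrel{P_i}\mu(i)$ and $i\succ_s j$; (3) there are no $i\in I$ and $s\in S$ with $s\mathrel{P_i}\mu(i)$ and $|\mu^{-1}(s)|<q_s$. Let $\mathcal S(E)$ be the set of stable matchings. A tier structure is a map $t=(t_s)_{s\in S}$ from $S$ onto $\{1,\dots,T\}$ for some integer $T\ge 1$; tier $k$ is $S_k=\{s\in S: t_s=k\}$. The tier structure $t$ is a refinement of $t'$ if, for all $a,b\in S$, $t'_a>t'_b$ implies $t_a>t_b$. The tiered deferred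 acceptance mechanism $TDA(t)$ works in rounds $k=1,\dots,T$. In round $k$ the student-proposing deferred acceptance algorithm is run with the students that are still unmatched (all of $I$ if $k=1$), the schools in $S_k$ with their quotas and priorities, and the preferences restricted to $S_k\cup\{i\}$: in each step, every student $i$ who is not tentatively accepted proposes to his best alternative in $S_k\cup\{i\}$ to which he has not yet proposed, and each school $s\in S_k$ tentatively accepts the $q_s$ highest-ranked students (all of them, if there are fewer) among its new proposers and those it accepted tentatively in the previous step, and rejects the others; when no new proposals are made, the tentative acceptances become the outcome of the round. Students matched to a school in a round keep that school, and students unmatched after round $T$ remain unmatched. For a mechanism $f$, a profile $Q=(Q_i)_{i\in I}$ of linear orders $Q_i$ over $S\cup\{i\}$ is a (pure) Nash equilibrium of the preference revelation game induced by $f$ at $E$ if $f(q,\succsim,(Q_i,Q_{-i}))(i)\mathrel{R_i} f(q,\succsim,(Q'_i,Q_{-i}))(i)$ for every $i\in I$ and every linear order $Q'_i$ over $S\cup\{i\}$. Let $\mathcal O^{f}(E)$ be the set of all outcomes $f(q,\succsim,Q)$ of such Nash equilibria $Q$. **Theorem.** For any school choice problem $E$ and any tier structure $t$: 1. $\mathcal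 S(E)\subseteq\mathcal O^{TDA(t)}(E)$; 2. for any tier structure $t'$ such that $t$ is a refinement of $t'$, $\mathcal O^{TDA(t)}(E)\subseteq\mathcal O^{TDA(t')}(E)$. -/

import Mathlib

/-- A school choice problem with students `I` and schools `S`: quotas, a priority profile and a
preference profile. The alternative `some s` of a student is the school `s`, and `none` is the
student himself (staying unmatched). In all linear orders a *larger* element is a *better* one:
`x R_i y` is `(E.pref i).le y x`, `x P_i y` is `(E.pref i).lt y x`, and `i ≻_s j` is
`(E.prio s).lt j i`. -/
structure SchoolChoice (I S : Type*) where
  quota : S → ℕ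
  prio : S → LinearOrder I
  pref : I → LinearOrder (Option S)

/-- A tier structure: the schools are partitioned into `T ≥ 1` nonempty tiers `1, …, T`, and
`tier s` is the tier of the school `s`. -/
structure TierStructure (S : Type*) where
  T : ℕ
  T_pos : 1 ≤ T
  tier : S → ℕ
  tier_mem : ∀ s, 1 ≤ tier s ∧ tier s ≤ T
  tier_nonempty : ∀ k, 1 ≤ k → k ≤ T → ∃ s, tier s = k

/-- `t` is a refinement of `t'`. -/
def TierStructure.Refines {S : Type*} (t t' : TierStructure S) : Prop :=
  ∀ a b : S, t'.tier a > t'.tier b → t.tier a > t.tier b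

namespace SchoolChoice

/-- The same students, schools, quotas and priorities, with the preference profile `Q`. -/
def withPref {I S : Type*} (E : SchoolChoice I S) (Q : I → LinearOrder (Option S)) :
    SchoolChoice I S where
  quota := E.quota
  prio := E.prio
  pref := Q

/-! ### Matchings and stability -/

/-- The students matched to `s`. -/
def assigned {I S : Type*} [Fintype I] [DecidableEq S] (μ : I → Option S) (s : S) : Finset I :=
  Finset.univ.filter (fun i => μ i = some s)

/-- An assignment is a matching if it respects the quotas. -/
def IsMatching {I S : Type*} [Fintype I] [DecidableEq S] (E : SchoolChoice I S)
    (μ : I → Option S) : Prop :=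
  ∀ s : S, (assigned μ s).card ≤ E.quota s

/-- Stable matchings: individually rational, without justified envy, and non-wasteful. -/
structure IsStable {I S : Type*} [Fintype I] [DecidableEq S] (E : SchoolChoice I S)
    (μ : I → Option S) : Prop where
  isMatching : E.IsMatching μ
  individuallyRational : ∀ i : I, (E.pref i).le none (μ i)
  noJustifiedEnvy : ¬ ∃ (i j : I) (s : S),
    μ j = some s ∧ (E.pref i).lt (μ i) (some s) ∧ (E.prio s).lt j i
  nonWasteful : ¬ ∃ (i : I) (s : S),
    (E.pref i).lt (μ i) (some s) ∧ (assigned μ s).card < E.quota s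

/-- The set of all stable matchings. -/
def stableMatchings {I S : Type*} [Fintype I] [DecidableEq S] (E : SchoolChoice I S) :
    Set (I → Option S) :=
  {μ | E.IsStable μ}

/-! ### The deferred acceptance algorithm

The algorithm is run with the students in `J` and the schools in `C` only. Its state is the set `X`
of pairs `(i, s)` such that the school `s` has rejected the student `i` in an earlier step. The
schools to which `i` has proposed are those that have rejected him and, if there is one, the school
that tentatively accepts him. So the best alternative that has not rejected `i` is the school that
tentatively accepts him, if there is one, and otherwise the best alternative to which he has not
proposed before. The preference of `i` truncated to `C` is the restriction of `E.pref i` to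
`C ∪ {i}`. -/

/-- The alternatives in `C ∪ {i}` that have not rejected student `i`. -/
def available {I S : Type*} [DecidableEq I] [DecidableEq S] (C : Finset S) (X : Finset (I × S))
    (i : I) : Finset (Option S) :=
  Finset.insertNone (C.filter (fun s => (i, s) ∉ X))

theorem available_nonempty {I S : Type*} [DecidableEq I] [DecidableEq S] (C : Finset S)
    (X : Finset (I × S)) (i : I) : (available C X i).Nonempty :=
  ⟨none, Finset.none_mem_insertNone⟩

/-- The alternative to which student `i` is proposing in the current step (made in this step, or
made earlier and tentatively accepted): his best alternative that has not rejected him. -/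
def proposal {I S : Type*} [DecidableEq I] [DecidableEq S] (E : SchoolChoice I S) (C : Finset S)
    (X : Finset (I × S)) (i : I) : Option S :=
  @Finset.max' (Option S) (E.pref i) (available C X i) (available_nonempty C X i)

/-- The students in `J` that school `s` considers in the current step: the new proposers and those
whom it accepted tentatively in the step before. -/
def proposers {I S : Type*} [DecidableEq I] [DecidableEq S] (E : SchoolChoice I S)
    (J : Finset I) (C : Finset S) (X : Finset (I × S)) (s : S) : Finset I :=
  J.filter (fun i => E.proposal C X i = some s)

/-- The students that school `s` tentatively accepts in the current step: the `q_s` highest ranked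
ones among those it considers. -/
def accepted {I S : Type*} [DecidableEq I] [DecidableEq S] (E : SchoolChoice I S)
    (J : Finset I) (C : Finset S) (X : Finset (I × S)) (s : S) : Finset I :=
  (E.proposers J C X s).filter (fun i =>
    (@Finset.filter I (fun j => (E.prio s).lt i j) ((E.prio s).toDecidableLT i)
      (E.proposers J C X s)).card < E.quota s)

/-- One step of the algorithm: every student that a school considers but does not tentatively
accept is rejected by it. -/
def daStep {I S : Type*} [DecidableEq I] [DecidableEq S] (E : SchoolChoice I S)
    (J : Finset I) (C : Finset S) (X : Finset (I × S)) : Finset (I × S) :=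
  X ∪ (J ×ˢ C).filter (fun p =>
    p.1 ∈ E.proposers J C X p.2 ∧ p.1 ∉ E.accepted J C X p.2)

theorem subset_daStep {I S : Type*} [DecidableEq I] [DecidableEq S] (E : SchoolChoice I S)
    (J : Finset I) (C : Finset S) (X : Finset (I × S)) : X ⊆ E.daStep J C X :=
  Finset.subset_union_left

/-- The steps are repeated until a step brings no rejection (so that no new proposals are made). -/
def daRun {I S : Type*} [Fintype I] [DecidableEq I] [Fintype S] [DecidableEq S]
    (E : SchoolChoice I S) (J : Finset I) (C : Finset S) (X : Finset (I × S)) :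
    Finset (I × S) :=
  if E.daStep J C X = X then X else daRun E J C (E.daStep J C X)
termination_by Fintype.card (I × S) - X.card
decreasing_by
  rename_i h
  have h1 : X ⊂ E.daStep J C X :=
    (E.subset_daStep J C X).ssubset_of_ne (fun e => h e.symm)
  have h2 := Finset.card_lt_card h1
  have h3 := Finset.card_le_univ (E.daStep J C X)
  omega

/-- The outcome of the deferred acceptance algorithm for the students in `J` and the schools in
`C`; students outside `J` are left unmatched. -/
def daOn {I S : Type*} [Fintype I] [DecidableEq I] [Fintype S] [DecidableEq S]
    (E : SchoolChoice I S) (J : Finset I) (C : Finset S) (i : I) : Option S :=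
  if i ∈ J then E.proposal C (E.daRun J C ∅) i else none

/-! ### The tiered deferred acceptance mechanism -/

/-- The assignment after the first `k` rounds: in round `k` the algorithm is run with the students
who are still unmatched and the schools of tier `k`; earlier assignments are final. -/
def tdaRounds {I S : Type*} [Fintype I] [DecidableEq I] [Fintype S] [DecidableEq S]
    (t : TierStructure S) (E : SchoolChoice I S) : ℕ → I → Option S
  | 0, _ => none
  | k + 1, i =>
    if tdaRounds t E k i = none then
      E.daOn (Finset.univ.filter (fun j => tdaRounds t E k j = none))
        (Finset.univ.filter (fun s => t.tier s = k + 1)) i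
    else tdaRounds t E k i

end SchoolChoice

/-- A mechanism assigns an outcome to every school choice problem. -/
abbrev Mechanism (I S : Type*) := SchoolChoice I S → I → Option S

/-- The tiered deferred acceptance mechanism under the tier structure `t`. -/
def TDA {I S : Type*} [Fintype I] [DecidableEq I] [Fintype S] [DecidableEq S]
    (t : TierStructure S) : Mechanism I S :=
  fun E => SchoolChoice.tdaRounds t E t.T

/-! ### The preference revelation game -/

/-- `Q` is a pure Nash equilibrium of the preference revelation game that the mechanism `f` induces
at `E`; outcomes are compared through the true preferences `E.pref`. -/
def IsNashEquilibrium {I S : Type*} [DecidableEq I] (f : Mechanism I S) (E : SchoolChoice I S)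
    (Q : I → LinearOrder (Option S)) : Prop :=
  ∀ (i : I) (Qi' : LinearOrder (Option S)),
    (E.pref i).le (f (E.withPref (Function.update Q i Qi')) i) (f (E.withPref Q) i)

/-- The set of pure Nash equilibrium outcomes under `f` at `E`. -/
def nashOutcomes {I S : Type*} [DecidableEq I] (f : Mechanism I S) (E : SchoolChoice I S) :
    Set (I → Option S) :=
  {μ | ∃ Q : I → LinearOrder (Option S), IsNashEquilibrium f E Q ∧ f (E.withPref Q) = μ}

/-!
Call a preference *tiered* when it ranks its acceptable schools by tier first. Sorting reported
preferences in this way (`tieredOrder`) does not change what the students do within any round of the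
tiered deferred acceptance mechanism. The outcome of the mechanism is the student-optimal stable
matching for the sorted preferences (`SchoolChoice.isStudentOptimal_TDA`): a student who prefers `s`, in the
tiered order, to his outcome was rejected by `s` in the round of `s`, which then is filled with
students of higher priority; and the classical argument that deferred acceptance never rejects a
student at a school where some stable matching places him carries over from round to round, because
a student who reaches round `k + 1` has no stable partner in the first `k` tiers.

So the outcome depends only on the tiered profile. If `t` refines `t'`, sorting by `t'` does not
change a preference sorted by `t`, nor does any sorting change a preference that accepts at most
one school (`onlyAccept`). Now let `Q` be an equilibrium for `t`, and `Q'` its sorting by `t`. Under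
`t'`, `Q'` yields the same outcome. If a deviation of `i` from `Q'` yields the alternative `x` for
him, the resulting matching remains stable when `i` instead accepts only `x`, so student-optimality
gives him `x` for this report too; but with this report `t` and `t'` yield the same outcome, so `i`
could reach `x` by deviating from `Q` under `t`, and `x` is no improvement.

A stable matching of the true preferences is supported by the reports that accept only the own
assignment: a deviator who entered a school that he prefers would have to take the place of a
student of higher priority who has ranked that school first.
-/

/-! ### Linear orders on alternatives -/

/-- The linear order that compares by the rank `r` first and breaks ties with `Q`. -/
@[reducible]
def rankFirst {α : Type*} (r : α → ℕ) (Q : LinearOrder α) : LinearOrder α :=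
  @LinearOrder.lift' α (ℕ ×ₗ α) (@Prod.Lex.instLinearOrder ℕ α _ Q)
    (fun x => toLex (r x, x)) (fun _ _ h => congrArg (fun p => (ofLex p).2) h)

theorem rankFirst_lt {α : Type*} (r : α → ℕ) (Q : LinearOrder α) (x y : α) :
    (rankFirst r Q).lt x y ↔ r x < r y ∨ r x = r y ∧ Q.lt x y :=
  @Prod.Lex.lt_iff ℕ α _ Q.toLT (toLex (r x, x)) (toLex (r y, y))

theorem LinearOrder.le_of_not_lt' {α : Type*} (Q : LinearOrder α) {x y : α} (h : ¬ Q.lt x y) :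
    Q.le y x :=
  @le_of_not_gt _ Q _ _ h

theorem LinearOrder.not_lt_of_le {α : Type*} (Q : LinearOrder α) {x y : α} (h : Q.le y x) :
    ¬ Q.lt x y :=
  @not_lt_of_ge _ Q.toPreorder _ _ h

theorem LinearOrder.lt_of_le_of_ne' {α : Type*} (Q : LinearOrder α) {x y : α} (h : Q.le x y)
    (hne : x ≠ y) : Q.lt x y :=
  @lt_of_le_of_ne _ Q.toPartialOrder _ _ h hne

theorem LinearOrder.le_of_lt' {α : Type*} (Q : LinearOrder α) {x y : α} (h : Q.lt x y) :
    Q.le x y :=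
  @le_of_lt _ Q.toPreorder _ _ h

theorem rankFirst_eq_self {α : Type*} (r : α → ℕ) (Q : LinearOrder α)
    (h : ∀ x y, r x < r y → Q.lt x y) : rankFirst r Q = Q := by
  have hlt : ∀ x y, (rankFirst r Q).lt x y ↔ Q.lt x y := by
    intro x y
    rw [rankFirst_lt]
    constructor
    · rintro (h1 | h1)
      · exact h x y h1
      · exact h1.2
    · intro h1
      rcases lt_trichotomy (r x) (r y) with h2 | h2 | h2
      · exact Or.inl h2
      · exact Or.inr ⟨h2, h1⟩
      · exact absurd (h y x h2) (Q.not_lt_of_le (Q.le_of_lt' h1))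
  refine LinearOrder.ext_lt fun {x y} => hlt x y

/-- The preference that puts `x` on top and declares every other school unacceptable. -/
@[reducible]
def onlyAccept {S : Type*} [DecidableEq S] (x : Option S) (Q : LinearOrder (Option S)) :
    LinearOrder (Option S) :=
  rankFirst (fun y => if y = x then 2 else if y = none then 1 else 0) Q

theorem onlyAccept_lt_top {S : Type*} [DecidableEq S] {x y : Option S}
    (Q : LinearOrder (Option S)) (h : y ≠ x) : (onlyAccept x Q).lt y x := by
  rw [onlyAccept, rankFirst_lt]
  left
  split_ifs <;> simp_all

theorem le_onlyAccept_top {S : Type*} [DecidableEq S] {x y : Option S}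
    (Q : LinearOrder (Option S)) : (onlyAccept x Q).le y x := by
  by_cases h : y = x
  · subst h
    exact (onlyAccept y Q).le_refl y
  · exact (onlyAccept x Q).le_of_lt' (onlyAccept_lt_top Q h)

theorem eq_of_onlyAccept_le {S : Type*} [DecidableEq S] {x y : Option S}
    {Q : LinearOrder (Option S)} (h : (onlyAccept x Q).le x y) : y = x := by
  by_contra hne
  exact (onlyAccept x Q).not_lt_of_le h (onlyAccept_lt_top Q hne)

theorem onlyAccept_eq_of_none_lt {S : Type*} [DecidableEq S] {x y : Option S}
    (Q : LinearOrder (Option S)) (h : (onlyAccept x Q).lt none y) : y = x := by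
  rw [onlyAccept, rankFirst_lt] at h
  by_contra hne
  by_cases hy : y = none
  · subst hy
    simp only [lt_irrefl, true_and, false_or] at h
  · by_cases hx : none = x <;> simp [hne, hy, hx] at h

open scoped Classical in
/-- The rank of an alternative in a tiered preference: an acceptable school ranks higher the lower
its tier is, and always above staying unmatched and above the unacceptable schools, whose common
rank is `0`. -/
noncomputable def tierRank {S : Type*} (t : TierStructure S) (Q : LinearOrder (Option S)) :
    Option S → ℕ
  | none => 0
  | some s => if Q.lt none (some s) then t.T + 1 - t.tier s else 0

/-- The preference that accepts the same schools as `Q` and ranks them by tier first, using `Q`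
only within a tier. -/
@[reducible]
noncomputable def tieredOrder {S : Type*} (t : TierStructure S) (Q : LinearOrder (Option S)) :
    LinearOrder (Option S) :=
  rankFirst (tierRank t Q) Q

section TieredOrder

variable {S : Type*} (t : TierStructure S) (Q : LinearOrder (Option S))

theorem tierRank_of_lt {s : S} (h : Q.lt none (some s)) :
    tierRank t Q (some s) = t.T + 1 - t.tier s := if_pos h

theorem tierRank_of_not_lt {x : Option S} (h : ¬ Q.lt none x) : tierRank t Q x = 0 := by
  cases x with
  | none => rfl
  | some s => exact if_neg h

theorem none_lt_tieredOrder (x : Option S) :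
    (tieredOrder t Q).lt none x ↔ Q.lt none x := by
  rw [tieredOrder, rankFirst_lt]
  by_cases h : Q.lt none x
  · cases x with
    | none => exact absurd h (@lt_irrefl _ Q.toPreorder _)
    | some s =>
      have := t.tier_mem s
      rw [tierRank_of_lt t Q h]
      simp only [tierRank, h, iff_true]
      left; omega
  · simp [tierRank_of_not_lt t Q h, h]

theorem tieredOrder_lt_of_tier_lt {a b : S} (hb : Q.lt none (some b))
    (h : t.tier b < t.tier a) : (tieredOrder t Q).lt (some a) (some b) := by
  rw [tieredOrder, rankFirst_lt, tierRank_of_lt t Q hb]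
  have := t.tier_mem a
  have := t.tier_mem b
  left
  by_cases ha : Q.lt none (some a)
  · rw [tierRank_of_lt t Q ha]; omega
  · rw [tierRank_of_not_lt t Q ha]; omega

theorem tieredOrder_lt_of_tier_eq {a b : S} (hb : Q.lt none (some b))
    (h : t.tier a = t.tier b) : (tieredOrder t Q).lt (some a) (some b) ↔
      Q.lt (some a) (some b) := by
  rw [tieredOrder, rankFirst_lt, tierRank_of_lt t Q hb]
  have := t.tier_mem b
  by_cases ha : Q.lt none (some a)
  · rw [tierRank_of_lt t Q ha, h]; simp
  · have h1 : Q.lt (some a) (some b) :=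
      @lt_of_le_of_lt _ Q.toPreorder _ _ _ (Q.le_of_not_lt' ha) hb
    simp only [h1, and_true, iff_true]
    rw [tierRank_of_not_lt t Q ha]
    left; omega

theorem tieredOrder_tieredOrder {t' : TierStructure S} (h : t.Refines t') :
    tieredOrder t' (tieredOrder t Q) = tieredOrder t Q := by
  refine rankFirst_eq_self _ _ fun x y hxy => ?_
  by_cases hy : (tieredOrder t Q).lt none y
  · by_cases hx : (tieredOrder t Q).lt none x
    · cases x with
      | none => exact hy
      | some a =>
        cases y with
        | none => exact absurd hy (@lt_irrefl _ (tieredOrder t Q).toPreorder _)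
        | some b =>
          rw [tierRank_of_lt _ _ hx, tierRank_of_lt _ _ hy] at hxy
          exact tieredOrder_lt_of_tier_lt t Q ((none_lt_tieredOrder t Q _).1 hy)
            (h a b (by omega))
    · exact @lt_of_le_of_lt _ (tieredOrder t Q).toPreorder _ _ _
        ((tieredOrder t Q).le_of_not_lt' hx) hy
  · rw [tierRank_of_not_lt t' (tieredOrder t Q) (x := y) hy] at hxy
    exact absurd hxy (Nat.not_lt_zero _)

theorem tieredOrder_onlyAccept [DecidableEq S] (x : Option S) :
    tieredOrder t (onlyAccept x Q) = onlyAccept x Q := by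
  refine rankFirst_eq_self _ _ fun z y hzy => ?_
  by_cases hy : (onlyAccept x Q).lt none y
  · obtain rfl := onlyAccept_eq_of_none_lt Q hy
    exact onlyAccept_lt_top Q fun h => by simp [h] at hzy
  · rw [tierRank_of_not_lt t (onlyAccept x Q) (x := y) hy] at hzy
    exact absurd hzy (Nat.not_lt_zero _)

end TieredOrder

/-! ### The best elements of a finite set -/

section TopElements

variable {α : Type*} [LinearOrder α]

theorem card_filter_above_le (P : Finset α) (q : ℕ) :
    (P.filter fun i => (P.filter fun j => i < j).card < q).card ≤ q := by
  set A := P.filter fun i => (P.filter fun j => i < j).card < q with hA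
  rcases A.eq_empty_or_nonempty with h | h
  · simp [h]
  · have hm := A.min'_mem h
    set m := A.min' h
    have h1 : A.erase m ⊆ P.filter fun j => m < j := by
      intro j hj
      rw [Finset.mem_erase] at hj
      exact Finset.mem_filter.2 ⟨(Finset.mem_filter.1 hj.2).1,
        lt_of_le_of_ne (A.min'_le j hj.2) hj.1.symm⟩
    have h2 := Finset.card_le_card h1
    have h3 := (Finset.mem_filter.1 hm).2
    rw [Finset.card_erase_of_mem hm] at h2
    omega

/-- The largest element outside the top `q` would have fewer than `q` elements above it if there
were fewer than `q` top elements. -/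
theorem le_card_filter_above {P : Finset α} {q : ℕ} (h : q ≤ P.card) :
    q ≤ (P.filter fun i => (P.filter fun j => i < j).card < q).card := by
  set A := P.filter fun i => (P.filter fun j => i < j).card < q with hA
  by_contra! hlt
  have hne : (P \ A).Nonempty := by
    rw [Finset.nonempty_iff_ne_empty, Ne, Finset.sdiff_eq_empty_iff_subset]
    intro hs
    have := Finset.card_le_card hs
    omega
  have hm := (P \ A).max'_mem hne
  set m := (P \ A).max' hne
  rw [Finset.mem_sdiff] at hm
  apply hm.2
  refine Finset.mem_filter.2 ⟨hm.1, lt_of_le_of_lt (Finset.card_le_card ?_) hlt⟩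
  intro j hj
  rw [Finset.mem_filter] at hj
  by_contra hjA
  exact absurd ((P \ A).le_max' j (Finset.mem_sdiff.2 ⟨hj.1, hjA⟩)) (not_le.2 hj.2)

theorem lt_of_mem_filter_above {P : Finset α} {q : ℕ} {i j : α}
    (hi : q ≤ (P.filter fun j => i < j).card)
    (hj : j ∈ P.filter fun i => (P.filter fun j => i < j).card < q) : i < j := by
  by_contra! hji
  have h1 : (P.filter fun k => i < k) ⊆ P.filter fun k => j < k :=
    Finset.monotone_filter_right _ fun k _ hk => lt_of_le_of_lt hji hk
  have := Finset.card_le_card h1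
  have := (Finset.mem_filter.1 hj).2
  omega

end TopElements

namespace SchoolChoice

/-! ### The deferred acceptance algorithm -/

section DeferredAcceptance

variable {I S : Type*} [DecidableEq I] [DecidableEq S]
  (E : SchoolChoice I S) (J : Finset I) (C : Finset S)

theorem some_mem_available {C : Finset S} {X : Finset (I × S)} {i : I} {s : S} :
    some s ∈ available C X i ↔ s ∈ C ∧ (i, s) ∉ X := by
  simp [available]

theorem proposal_mem (X : Finset (I × S)) (i : I) : E.proposal C X i ∈ available C X i :=
  @Finset.max'_mem _ (E.pref i) _ _

theorem le_proposal {C : Finset S} {X : Finset (I × S)} {i : I} {x : Option S}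
    (h : x ∈ available C X i) : (E.pref i).le x (E.proposal C X i) :=
  @Finset.le_max' _ (E.pref i) _ _ h

theorem proposal_eq_of_subset {X Y : Finset (I × S)} {i : I} {s : S} (hXY : X ⊆ Y)
    (hX : E.proposal C X i = some s) (hY : (i, s) ∉ Y) : E.proposal C Y i = some s := by
  have hs := E.proposal_mem C X i
  rw [hX, some_mem_available] at hs
  refine (E.pref i).le_antisymm _ _ ?_ (E.le_proposal (some_mem_available.2 ⟨hs.1, hY⟩))
  rw [← hX]
  apply E.le_proposal
  have h := E.proposal_mem C Y i
  cases hp : E.proposal C Y i with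
  | none => exact Finset.none_mem_insertNone
  | some b =>
    rw [hp, some_mem_available] at h
    exact some_mem_available.2 ⟨h.1, fun hb => h.2 (hXY hb)⟩

theorem none_lt_of_proposal {X : Finset (I × S)} {i : I} {s : S}
    (h : E.proposal C X i = some s) : (E.pref i).lt none (some s) :=
  (E.pref i).lt_of_le_of_ne' (h ▸ E.le_proposal Finset.none_mem_insertNone) (by simp)

theorem mem_proposers {X : Finset (I × S)} {i : I} {s : S} :
    i ∈ E.proposers J C X s ↔ i ∈ J ∧ E.proposal C X i = some s :=
  Finset.mem_filter

theorem mem_of_mem_proposers {X : Finset (I × S)} {i : I} {s : S}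
    (h : i ∈ E.proposers J C X s) : s ∈ C ∧ (i, s) ∉ X := by
  rw [mem_proposers] at h
  exact some_mem_available.1 (h.2 ▸ E.proposal_mem C X i)

theorem mem_daStep {X : Finset (I × S)} {i : I} {s : S} :
    (i, s) ∈ E.daStep J C X ↔
      (i, s) ∈ X ∨ i ∈ E.proposers J C X s ∧ i ∉ E.accepted J C X s := by
  simp only [daStep, Finset.mem_union, Finset.mem_filter, Finset.mem_product]
  constructor
  · rintro (h | h)
    · exact Or.inl h
    · exact Or.inr h.2
  · rintro (h | h)
    · exact Or.inl h
    · exact Or.inr ⟨⟨((E.mem_proposers J C).1 h.1).1, (E.mem_of_mem_proposers J C h.1).1⟩, h⟩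

theorem accepted_subset (X : Finset (I × S)) (s : S) :
    E.accepted J C X s ⊆ E.proposers J C X s :=
  Finset.filter_subset _ _

theorem accepted_subset_proposers_daStep (X : Finset (I × S)) (s : S) :
    E.accepted J C X s ⊆ E.proposers J C (E.daStep J C X) s := by
  intro j hj
  have hp := E.accepted_subset J C X s hj
  have h1 := (E.mem_proposers J C).1 hp
  refine (E.mem_proposers J C).2 ⟨h1.1, E.proposal_eq_of_subset C (E.subset_daStep J C X) h1.2 ?_⟩
  rw [mem_daStep]
  rintro (h | h)
  · exact (E.mem_of_mem_proposers J C hp).2 h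
  · exact h.2 hj

/-- If at least `q_s` students considered by `s` have higher priority than `i`, then so have the
students accepted by `s`, and they fill the quota. -/
theorem accepted_of_quota_le {X A : Finset _} {i : I} {s : S} (hA : A ⊆ E.proposers J C X s)
    (hi : ∀ j ∈ A, (E.prio s).lt i j) (hq : E.quota s ≤ A.card) :
    E.quota s ≤ (E.accepted J C X s).card ∧
      ∀ j ∈ E.accepted J C X s, (E.prio s).lt i j := by
  let := E.prio s
  refine ⟨le_card_filter_above (hq.trans (Finset.card_le_card hA)), fun j hj =>
    lt_of_mem_filter_above (hq.trans (Finset.card_le_card fun k hk =>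
      Finset.mem_filter.2 ⟨hA hk, hi k hk⟩)) hj⟩

theorem exists_of_not_accepted {X : Finset (I × S)} {i : I} {s : S}
    (hp : i ∈ E.proposers J C X s) (ha : i ∉ E.accepted J C X s) :
    ∃ A ⊆ E.proposers J C X s, (∀ j ∈ A, (E.prio s).lt i j) ∧ E.quota s ≤ A.card := by
  let := E.prio s
  refine ⟨(E.proposers J C X s).filter fun j => i < j, Finset.filter_subset _ _,
    fun j hj => (Finset.mem_filter.1 hj).2, ?_⟩
  by_contra! h
  exact ha (Finset.mem_filter.2 ⟨hp, h⟩)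

theorem card_accepted_le (X : Finset (I × S)) (s : S) :
    (E.accepted J C X s).card ≤ E.quota s := by
  let := E.prio s
  exact card_filter_above_le _ _

variable [Fintype I] [Fintype S]

theorem daRun_induction {p : Finset (I × S) → Prop} (hstep : ∀ X, p X → p (E.daStep J C X))
    (X : Finset (I × S)) (hX : p X) : p (E.daRun J C X) := by
  induction X using daRun.induct (E := E) (J := J) (C := C) with
  | case1 X h => rw [daRun, if_pos h]; exact hX
  | case2 X h ih => rw [daRun, if_neg h]; exact ih (hstep X hX)

theorem daStep_daRun (X : Finset (I × S)) :
    E.daStep J C (E.daRun J C X) = E.daRun J C X := by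
  induction X using daRun.induct (E := E) (J := J) (C := C) with
  | case1 X h => rw [daRun, if_pos h]; exact h
  | case2 X h ih => rw [daRun, if_neg h]; exact ih

theorem proposers_daRun_subset (X : Finset (I × S)) (s : S) :
    E.proposers J C (E.daRun J C X) s ⊆ E.accepted J C (E.daRun J C X) s := by
  intro i hi
  by_contra h
  have := (E.mem_daStep J C).2 (Or.inr ⟨hi, h⟩)
  rw [daStep_daRun] at this
  exact (E.mem_of_mem_proposers J C hi).2 this

/-- A school that has rejected `i` ends with a full set of students of higher priority: the
students it accepts in a step are still considered in the next one. -/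
theorem exists_of_mem_daRun {i : I} {s : S} (h : (i, s) ∈ E.daRun J C ∅) :
    ∃ A ⊆ E.proposers J C (E.daRun J C ∅) s,
      (∀ j ∈ A, (E.prio s).lt i j) ∧ E.quota s ≤ A.card := by
  refine E.daRun_induction J C (p := fun X => ∀ i s, (i, s) ∈ X →
    ∃ A ⊆ E.proposers J C X s, (∀ j ∈ A, (E.prio s).lt i j) ∧ E.quota s ≤ A.card)
    ?_ ∅ (by simp) i s h
  intro X hX i s his
  have key : ∃ A ⊆ E.proposers J C X s, (∀ j ∈ A, (E.prio s).lt i j) ∧ E.quota s ≤ A.card := by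
    rcases (E.mem_daStep J C).1 his with h | h
    · exact hX i s h
    · exact E.exists_of_not_accepted J C h.1 h.2
  obtain ⟨A, hA, hi, hq⟩ := key
  obtain ⟨h1, h2⟩ := E.accepted_of_quota_le J C hA hi hq
  exact ⟨_, E.accepted_subset_proposers_daStep J C X s, h2, h1⟩

/-- Deferred acceptance never rejects a student at his school under `ν`, if `ν` respects the quotas
and no student `j` has justified envy under `ν` at a school that he finds acceptable and at least
as good as any school of `C` that `ν` assigns to him. -/
theorem notMem_daRun {ν : I → Option S} (hcard : ∀ s ∈ C, (assigned ν s).card ≤ E.quota s)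
    (hν : ∀ i j s, s ∈ C → j ∈ J → ν i = some s → (E.prio s).lt i j →
      (E.pref j).lt none (some s) →
      (∀ s' ∈ C, ν j = some s' → (E.pref j).le (some s') (some s)) → ν j = some s)
    {i : I} {s : S} (his : ν i = some s) : (i, s) ∉ E.daRun J C ∅ := by
  refine E.daRun_induction J C (p := fun X => ∀ i s, ν i = some s → (i, s) ∉ X)
    ?_ ∅ (by simp) i s his
  intro X hX i s his hmem
  rcases (E.mem_daStep J C).1 hmem with h | h
  · exact hX i s his h
  obtain ⟨A, hA, hi, hq⟩ := E.exists_of_not_accepted J C h.1 h.2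
  have hs := (E.mem_of_mem_proposers J C h.1).1
  -- Every student of `A` is matched to `s` under `ν`, and so is `i`: the quota is exceeded.
  have hsub : insert i A ⊆ assigned ν s := by
    intro j hj
    refine Finset.mem_filter.2 ⟨Finset.mem_univ _, ?_⟩
    rcases Finset.mem_insert.1 hj with rfl | hj
    · exact his
    have hjp := (E.mem_proposers J C).1 (hA hj)
    refine hν i j s hs hjp.1 his (hi j hj) (E.none_lt_of_proposal C hjp.2) fun s' hs' hj' => ?_
    rw [← hjp.2]
    exact E.le_proposal (some_mem_available.2 ⟨hs', hX j s' hj'⟩)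
  have hiA : i ∉ A := fun hiA => @lt_irrefl _ (E.prio s).toPreorder _ (hi i hiA)
  have := Finset.card_le_card hsub
  rw [Finset.card_insert_of_notMem hiA] at this
  have := hcard s hs
  omega

variable {J C}

theorem daOn_eq_some {i : I} {s : S} :
    E.daOn J C i = some s ↔ i ∈ E.proposers J C (E.daRun J C ∅) s := by
  rw [mem_proposers, daOn]
  split_ifs with h <;> simp [h]

theorem mem_of_daOn_eq_some {i : I} {s : S} (h : E.daOn J C i = some s) :
    s ∈ C ∧ (E.pref i).lt none (some s) :=
  have h' := (E.daOn_eq_some).1 h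
  ⟨(E.mem_of_mem_proposers J C h').1, E.none_lt_of_proposal C ((E.mem_proposers J C).1 h').2⟩

theorem card_daOn_le (s : S) : (assigned (E.daOn J C) s).card ≤ E.quota s := by
  refine (Finset.card_le_card fun i hi => ?_).trans (E.card_accepted_le J C (E.daRun J C ∅) s)
  exact E.proposers_daRun_subset J C _ _ (E.daOn_eq_some.1 (Finset.mem_filter.1 hi).2)

theorem le_daOn {i : I} {s : S} (hi : i ∈ J) (hs : s ∈ C) (h : (i, s) ∉ E.daRun J C ∅) :
    (E.pref i).le (some s) (E.daOn J C i) := by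
  rw [daOn, if_pos hi]
  exact E.le_proposal (some_mem_available.2 ⟨hs, h⟩)

theorem exists_of_daOn_lt {i : I} {s : S} (hi : i ∈ J) (hs : s ∈ C)
    (h : (E.pref i).lt (E.daOn J C i) (some s)) :
    ∃ A : Finset I, (∀ j ∈ A, E.daOn J C j = some s ∧ (E.prio s).lt i j) ∧
      E.quota s ≤ A.card := by
  have hr : (i, s) ∈ E.daRun J C ∅ := by
    by_contra hr
    exact (E.pref i).not_lt_of_le (E.le_daOn hi hs hr) h
  obtain ⟨A, hA, h1, h2⟩ := E.exists_of_mem_daRun J C hr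
  exact ⟨A, fun j hj => ⟨E.daOn_eq_some.2 (hA hj), h1 j hj⟩, h2⟩

end DeferredAcceptance

/-! ### Tiered deferred acceptance and stability -/

section Tiered

variable {I S : Type*} [Fintype I] [DecidableEq S]

/-- A stable matching that every student weakly prefers to every other stable matching. -/
def IsStudentOptimal (E : SchoolChoice I S) (μ : I → Option S) : Prop :=
  E.IsStable μ ∧ ∀ ν, E.IsStable ν → ∀ i, (E.pref i).le (ν i) (μ i)

theorem IsStudentOptimal.unique {E : SchoolChoice I S} {μ ν : I → Option S}
    (hμ : E.IsStudentOptimal μ) (hν : E.IsStudentOptimal ν) : μ = ν :=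
  funext fun i => (E.pref i).le_antisymm _ _ (hν.2 μ hμ.1 i) (hμ.2 ν hν.1 i)

/-- A stable matching remains stable when each student either keeps his preference or finds only
his own assignment acceptable. -/
theorem IsStable.of_onlyAccept {E : SchoolChoice I S} {μ : I → Option S}
    {Q Q' : I → LinearOrder (Option S)} (h : (E.withPref Q).IsStable μ)
    (hQ : ∀ i, Q' i = Q i ∨ ∃ R, Q' i = onlyAccept (μ i) R) :
    (E.withPref Q').IsStable μ := by
  have hlt : ∀ i x, (Q' i).lt (μ i) x → (Q i).lt (μ i) x := by
    intro i x hx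
    rcases hQ i with hi | ⟨R, hi⟩
    · rwa [hi] at hx
    · rw [hi] at hx
      refine absurd hx ((onlyAccept (μ i) R).not_lt_of_le ?_)
      exact le_onlyAccept_top R
  refine ⟨h.isMatching, fun i => ?_, ?_, ?_⟩
  · change (Q' i).le none (μ i)
    rcases hQ i with hi | ⟨R, hi⟩
    · rw [hi]; exact h.individuallyRational i
    · rw [hi]; exact le_onlyAccept_top R
  · rintro ⟨i, j, s, h1, h2, h3⟩
    exact h.noJustifiedEnvy ⟨i, j, s, h1, hlt i _ h2, h3⟩
  · rintro ⟨i, s, h1, h2⟩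
    exact h.nonWasteful ⟨i, s, hlt i _ h1, h2⟩

/-- The school choice problem in which every student ranks the schools by tier first. -/
noncomputable def tiered (E : SchoolChoice I S) (t : TierStructure S) : SchoolChoice I S :=
  E.withPref fun i => tieredOrder t (E.pref i)

variable [DecidableEq I] [Fintype S] (E : SchoolChoice I S) (t : TierStructure S)

theorem tdaRounds_succ_of_eq_none {k : ℕ} {i : I} (h : tdaRounds t E k i = none) :
    tdaRounds t E (k + 1) i = E.daOn (Finset.univ.filter (fun j => tdaRounds t E k j = none))
      (Finset.univ.filter (fun s => t.tier s = k + 1)) i := by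
  rw [tdaRounds, if_pos h]

theorem tdaRounds_succ_of_eq_some {k : ℕ} {i : I} {s : S} (h : tdaRounds t E k i = some s) :
    tdaRounds t E (k + 1) i = some s := by
  rw [tdaRounds, if_neg (by simp [h]), h]

theorem tdaRounds_eq_some {k : ℕ} {i : I} {s : S} (h : tdaRounds t E k i = some s) :
    t.tier s ≤ k ∧ (E.pref i).lt none (some s) := by
  induction k with
  | zero => simp [tdaRounds] at h
  | succ k ih =>
    cases hk : tdaRounds t E k i with
    | none =>
      rw [tdaRounds_succ_of_eq_none E t hk] at h
      have := E.mem_of_daOn_eq_some h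
      exact ⟨by have := (Finset.mem_filter.1 this.1).2; omega, this.2⟩
    | some s' =>
      rw [tdaRounds_succ_of_eq_some E t hk] at h
      have := ih (hk.trans h)
      exact ⟨by omega, this.2⟩

/-- Round `k + 1` leaves the students of the schools of earlier tiers as they are, and fills the
schools of tier `k + 1` by deferred acceptance. -/
theorem tdaRounds_succ_eq_some_iff {k : ℕ} {i : I} {s : S} :
    tdaRounds t E (k + 1) i = some s ↔
      if t.tier s = k + 1 then
        E.daOn (Finset.univ.filter (fun j => tdaRounds t E k j = none))
          (Finset.univ.filter (fun s => t.tier s = k + 1)) i = some s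
      else tdaRounds t E k i = some s := by
  cases hk : tdaRounds t E k i with
  | none =>
    rw [tdaRounds_succ_of_eq_none E t hk]
    split_ifs with h
    · rfl
    · simp only [iff_false]
      exact fun h' => h (Finset.mem_filter.1 (E.mem_of_daOn_eq_some h').1).2
  | some s' =>
    rw [tdaRounds_succ_of_eq_some E t hk]
    split_ifs with h
    · have h1 := (tdaRounds_eq_some E t hk).1
      constructor
      · rintro ⟨⟩
        omega
      · intro h'
        rw [daOn, if_neg (by simp [hk])] at h'
        cases h'
    · rfl

theorem card_tdaRounds_le (k : ℕ) (s : S) :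
    (assigned (tdaRounds t E k) s).card ≤ E.quota s := by
  induction k with
  | zero => simp [assigned, tdaRounds]
  | succ k ih =>
    by_cases h : t.tier s = k + 1
    · refine le_trans (Finset.card_le_card fun i hi => ?_) (E.card_daOn_le
        (J := Finset.univ.filter (fun j => tdaRounds t E k j = none))
        (C := Finset.univ.filter (fun s => t.tier s = k + 1)) s)
      simp only [assigned, Finset.mem_filter, Finset.mem_univ, true_and] at hi ⊢
      rwa [tdaRounds_succ_eq_some_iff, if_pos h] at hi
    · refine le_trans (Finset.card_le_card fun i hi => ?_) ih
      simp only [assigned, Finset.mem_filter, Finset.mem_univ, true_and] at hi ⊢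
      rwa [tdaRounds_succ_eq_some_iff, if_neg h] at hi

theorem exists_of_tdaRounds_lt {k : ℕ} {i : I} {s : S} (hs : t.tier s ≤ k)
    (hn : (E.pref i).lt none (some s))
    (h : (tieredOrder t (E.pref i)).lt (tdaRounds t E k i) (some s)) :
    ∃ A : Finset I, (∀ j ∈ A, tdaRounds t E k j = some s ∧ (E.prio s).lt i j) ∧
      E.quota s ≤ A.card := by
  induction k with
  | zero => have := t.tier_mem s; omega
  | succ k ih =>
    have hlow : t.tier s ≠ k + 1 → (tieredOrder t (E.pref i)).lt (tdaRounds t E k i) (some s) →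
        ∃ A : Finset I, (∀ j ∈ A, tdaRounds t E (k + 1) j = some s ∧ (E.prio s).lt i j) ∧
          E.quota s ≤ A.card := by
      intro hne hlt
      obtain ⟨A, hA, hq⟩ := ih (by omega) hlt
      exact ⟨A, fun j hj => ⟨tdaRounds_succ_of_eq_some E t (hA j hj).1, (hA j hj).2⟩, hq⟩
    cases hk : tdaRounds t E k i with
    | some a =>
      rw [tdaRounds_succ_of_eq_some E t hk] at h
      refine hlow (fun hs' => ?_) (hk ▸ h)
      have ha := tdaRounds_eq_some E t hk
      exact (tieredOrder t (E.pref i)).not_lt_of_le ((tieredOrder t (E.pref i)).le_of_lt'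
        (tieredOrder_lt_of_tier_lt t (E.pref i) ha.2 (by omega))) h
    | none =>
      by_cases hs' : t.tier s = k + 1
      · rw [tdaRounds_succ_of_eq_none E t hk] at h
        obtain ⟨A, hA, hq⟩ := E.exists_of_daOn_lt
          (J := Finset.univ.filter (fun j => tdaRounds t E k j = none))
          (C := Finset.univ.filter (fun s => t.tier s = k + 1)) (i := i) (s := s)
          (by simp [hk]) (by simp [hs']) (by
            cases hd : E.daOn (Finset.univ.filter (fun j => tdaRounds t E k j = none))
              (Finset.univ.filter (fun s => t.tier s = k + 1)) i with
            | none => exact hn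
            | some a =>
              rw [hd] at h
              have ha := (Finset.mem_filter.1 (E.mem_of_daOn_eq_some hd).1).2
              exact (tieredOrder_lt_of_tier_eq t _ hn (by omega)).1 h)
        refine ⟨A, fun j hj => ⟨?_, (hA j hj).2⟩, hq⟩
        rw [tdaRounds_succ_eq_some_iff, if_pos hs']
        exact (hA j hj).1
      · exact hlow hs' (hk ▸ (none_lt_tieredOrder t _ _).2 hn)

theorem le_tdaRounds {ν : I → Option S} (hν : (E.tiered t).IsStable ν) {k : ℕ} {i : I} {s : S}
    (his : ν i = some s) (hs : t.tier s ≤ k) :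
    (tieredOrder t (E.pref i)).le (some s) (tdaRounds t E k i) := by
  induction k generalizing i s with
  | zero => have := t.tier_mem s; omega
  | succ k ih =>
    have hacc : ∀ {j b}, ν j = some b → (E.pref j).lt none (some b) := fun {j b} hj =>
      (none_lt_tieredOrder t _ _).1 ((tieredOrder t (E.pref j)).lt_of_le_of_ne'
        (hj ▸ hν.individuallyRational j) (by simp))
    -- A student still unmatched after round `k` is matched in a later tier by `ν`, if at all.
    have hlate : ∀ {j b}, tdaRounds t E k j = none → ν j = some b → k < t.tier b := by
      intro j b hk hj
      by_contra! hb
      exact (tieredOrder t (E.pref j)).not_lt_of_le (hk ▸ ih hj hb)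
        ((none_lt_tieredOrder t _ _).2 (hacc hj))
    cases hk : tdaRounds t E k i with
    | some a =>
      rw [tdaRounds_succ_of_eq_some E t hk, ← hk]
      by_cases hs' : t.tier s ≤ k
      · exact ih his hs'
      · rw [hk]
        have ha := tdaRounds_eq_some E t hk
        exact (tieredOrder t (E.pref i)).le_of_lt'
          (tieredOrder_lt_of_tier_lt t (E.pref i) ha.2 (by omega))
    | none =>
      have hs' : t.tier s = k + 1 := by have := hlate hk his; omega
      rw [tdaRounds_succ_of_eq_none E t hk]
      have hnot := E.notMem_daRun (Finset.univ.filter (fun j => tdaRounds t E k j = none))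
        (Finset.univ.filter (fun s => t.tier s = k + 1)) (ν := ν)
        (fun s _ => hν.isMatching s) (by
          intro i' j b hb hj hi' hprio hn hbest
          by_contra hne
          simp only [Finset.mem_filter, Finset.mem_univ, true_and] at hb hj hbest
          refine hν.noJustifiedEnvy ⟨j, i', b, hi', ?_, hprio⟩
          change (tieredOrder t (E.pref j)).lt (ν j) (some b)
          cases hc : ν j with
          | none => exact (none_lt_tieredOrder t _ _).2 hn
          | some c =>
            have := hlate hj hc
            by_cases hct : t.tier c = k + 1
            · exact (tieredOrder_lt_of_tier_eq t _ hn (by omega)).2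
                ((E.pref j).lt_of_le_of_ne' (hbest c hct hc) (hc ▸ hne))
            · exact tieredOrder_lt_of_tier_lt t _ hn (by omega)) his
      have hle := E.le_daOn (by simp [hk]) (by simp [hs']) hnot
      cases hd : E.daOn (Finset.univ.filter (fun j => tdaRounds t E k j = none))
          (Finset.univ.filter (fun s => t.tier s = k + 1)) i with
      | none => exact absurd (hacc his) ((E.pref i).not_lt_of_le (hd ▸ hle))
      | some a =>
        rw [hd] at hle
        have ha := (Finset.mem_filter.1 (E.mem_of_daOn_eq_some hd).1).2
        apply (tieredOrder t (E.pref i)).le_of_not_lt'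
        rw [tieredOrder_lt_of_tier_eq t _ (hacc his) (by omega)]
        exact (E.pref i).not_lt_of_le hle

/-- The tiered deferred acceptance mechanism selects the student-optimal stable matching for the
preferences that rank the schools by tier first. -/
theorem isStudentOptimal_TDA : (E.tiered t).IsStudentOptimal (TDA t E) := by
  have hir : ∀ i, (tieredOrder t (E.pref i)).le none (TDA t E i) := by
    intro i
    cases h : TDA t E i with
    | none => exact (tieredOrder t (E.pref i)).le_refl _
    | some s =>
      exact (tieredOrder t (E.pref i)).le_of_lt'
        ((none_lt_tieredOrder t _ _).2 (tdaRounds_eq_some E t h).2)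
  have hfull : ∀ i s, (tieredOrder t (E.pref i)).lt (TDA t E i) (some s) →
      ∃ A : Finset I, (∀ j ∈ A, TDA t E j = some s ∧ (E.prio s).lt i j) ∧
        E.quota s ≤ A.card := fun i s h =>
    exists_of_tdaRounds_lt E t (t.tier_mem s).2 ((none_lt_tieredOrder t _ _).1
      (@lt_of_le_of_lt _ (tieredOrder t (E.pref i)).toPreorder _ _ _ (hir i) h)) h
  refine ⟨⟨fun s => card_tdaRounds_le E t _ s, hir, ?_, ?_⟩, fun ν hν i => ?_⟩
  · rintro ⟨i, j, s, hj, hlt, hprio⟩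
    obtain ⟨A, hA, hq⟩ := hfull i s hlt
    have hjA : j ∉ A := fun h => (E.prio s).not_lt_of_le
      ((E.prio s).le_of_lt' hprio) (hA j h).2
    have hsub : insert j A ⊆ assigned (TDA t E) s := by
      intro l hl
      refine Finset.mem_filter.2 ⟨Finset.mem_univ _, ?_⟩
      rcases Finset.mem_insert.1 hl with rfl | hl
      · exact hj
      · exact (hA l hl).1
    have h1 := Finset.card_le_card hsub
    rw [Finset.card_insert_of_notMem hjA] at h1
    have h2 : (assigned (TDA t E) s).card ≤ E.quota s := card_tdaRounds_le E t _ s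
    omega
  · rintro ⟨i, s, hlt, hcard⟩
    obtain ⟨A, hA, hq⟩ := hfull i s hlt
    have h1 : A.card ≤ (assigned (TDA t E) s).card := Finset.card_le_card fun j hj =>
      Finset.mem_filter.2 ⟨Finset.mem_univ _, (hA j hj).1⟩
    exact absurd (hq.trans h1) (not_le.2 hcard)
  · cases h : ν i with
    | none => exact hir i
    | some s => exact le_tdaRounds E t hν h (t.tier_mem s).2

theorem TDA_eq_of_tiered_eq {E E' : SchoolChoice I S} {t t' : TierStructure S}
    (h : E.tiered t = E'.tiered t') : TDA t E = TDA t' E' :=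
  (isStudentOptimal_TDA E t).unique (h ▸ isStudentOptimal_TDA E' t')

theorem isStudentOptimal_TDA_withPref (Q : I → LinearOrder (Option S)) :
    (E.withPref fun i => tieredOrder t (Q i)).IsStudentOptimal (TDA t (E.withPref Q)) :=
  isStudentOptimal_TDA (E.withPref Q) t

/-! ### Equilibrium outcomes -/

/-- Stable matchings are equilibrium outcomes: let every student accept only his assignment. A
deviator who obtains a better school `s` displaces a student of `s`, who has higher priority. -/
theorem stableMatchings_subset_nashOutcomes :
    E.stableMatchings ⊆ nashOutcomes (TDA t) E := by
  intro μ hμ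
  have hμ : E.IsStable μ := hμ
  set Q : I → LinearOrder (Option S) := fun i => onlyAccept (μ i) (E.pref i) with hQ
  have hout : TDA t (E.withPref Q) = μ := by
    have hs : (E.withPref fun i => tieredOrder t (Q i)).IsStable μ :=
      IsStable.of_onlyAccept (E := E) (Q := E.pref) hμ fun i =>
        Or.inr ⟨E.pref i, tieredOrder_onlyAccept t _ _⟩
    funext i
    have hle : (tieredOrder t (Q i)).le _ _ := (isStudentOptimal_TDA_withPref E t Q).2 μ hs i
    rw [hQ, tieredOrder_onlyAccept] at hle
    exact eq_of_onlyAccept_le hle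
  refine ⟨Q, fun i R => ?_, hout⟩
  rw [hout]
  obtain ⟨hν, -⟩ := isStudentOptimal_TDA_withPref E t (Function.update Q i R)
  set ν := TDA t (E.withPref (Function.update Q i R))
  apply (E.pref i).le_of_not_lt'
  intro hlt
  cases hs : ν i with
  | none => exact (E.pref i).not_lt_of_le (hμ.individuallyRational i) (hs ▸ hlt)
  | some s =>
    rw [hs] at hlt
    have hfull : E.quota s ≤ (assigned μ s).card := by
      by_contra! h
      exact hμ.nonWasteful ⟨i, s, hlt, h⟩
    have hcard : (assigned ν s).card ≤ E.quota s := hν.isMatching s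
    have hiμ : i ∉ assigned μ s := fun h => by
      rw [(Finset.mem_filter.1 h).2] at hlt
      exact @lt_irrefl _ (E.pref i).toPreorder _ hlt
    have hiν : i ∈ assigned ν s := Finset.mem_filter.2 ⟨Finset.mem_univ _, hs⟩
    obtain ⟨j, hjμ, hjν⟩ : ∃ j ∈ assigned μ s, j ∉ assigned ν s := by
      by_contra! h
      have h1 := Finset.card_le_card (Finset.insert_subset hiν h)
      rw [Finset.card_insert_of_notMem hiμ] at h1
      omega
    have hji : j ≠ i := fun h => hiμ (h ▸ hjμ)
    have hj : μ j = some s := (Finset.mem_filter.1 hjμ).2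
    have hprio : (E.prio s).lt i j := (E.prio s).lt_of_le_of_ne'
      ((E.prio s).le_of_not_lt' fun h => hμ.noJustifiedEnvy ⟨i, j, s, hj, hlt, h⟩) hji.symm
    refine hν.noJustifiedEnvy ⟨j, i, s, hs, ?_, hprio⟩
    change (tieredOrder t (Function.update Q i R j)).lt (ν j) (some s)
    rw [Function.update_of_ne hji, hQ, tieredOrder_onlyAccept, ← hj]
    exact onlyAccept_lt_top _ fun h => hjν (Finset.mem_filter.2 ⟨Finset.mem_univ _, h.trans hj⟩)

/-- Equilibrium strategies for the finer tier structure become equilibrium strategies for the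
coarser one after sorting them by the finer tiers. Any alternative that a deviation reaches under
the coarser structure is also reached by accepting nothing else, and this deviation has the same
outcome under both structures. -/
theorem nashOutcomes_subset_of_refines {t' : TierStructure S} (h : t.Refines t') :
    nashOutcomes (TDA t) E ⊆ nashOutcomes (TDA t') E := by
  rintro μ ⟨Q, hQ, rfl⟩
  set Q' : I → LinearOrder (Option S) := fun i => tieredOrder t (Q i) with hQ'
  have hout : TDA t' (E.withPref Q') = TDA t (E.withPref Q) := by
    apply TDA_eq_of_tiered_eq
    simp only [tiered, withPref, hQ', tieredOrder_tieredOrder t _ h]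
  refine ⟨Q', fun i R => ?_, hout⟩
  rw [hout]
  set ν := TDA t' (E.withPref (Function.update Q' i R)) with hν
  have hdev : TDA t (E.withPref (Function.update Q i (onlyAccept (ν i) R))) i = ν i := by
    have hs := (isStudentOptimal_TDA_withPref E t' (Function.update Q' i R)).1
    have hs' : (E.withPref fun j => tieredOrder t
        (Function.update Q i (onlyAccept (ν i) R) j)).IsStable ν := by
      refine hs.of_onlyAccept fun j => ?_
      by_cases hj : j = i
      · subst hj
        right
        exact ⟨R, by rw [Function.update_self, tieredOrder_onlyAccept]⟩
      · left
        rw [Function.update_of_ne hj, Function.update_of_ne hj, hQ', tieredOrder_tieredOrder t _ h]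
    have hle : (tieredOrder t (Function.update Q i (onlyAccept (ν i) R) i)).le _ _ :=
      (isStudentOptimal_TDA_withPref E t (Function.update Q i (onlyAccept (ν i) R))).2 ν hs' i
    rw [Function.update_self, tieredOrder_onlyAccept] at hle
    exact eq_of_onlyAccept_le hle
  rw [← hdev]
  exact hQ i (onlyAccept (ν i) R)

end Tiered

end SchoolChoice

theorem theorem1 {I S : Type*} [Fintype I] [DecidableEq I] [Fintype S] [DecidableEq S]
    (E : SchoolChoice I S) (t : TierStructure S) :
    E.stableMatchings ⊆ nashOutcomes (TDA t) E ∧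
      ∀ t' : TierStructure S, t.Refines t' →
        nashOutcomes (TDA t) E ⊆ nashOutcomes (TDA t') E :=
  ⟨E.stableMatchings_subset_nashOutcomes t, fun _ h => E.nashOutcomes_subset_of_refines t h⟩
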